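/- Fix $p\in(0,1)$ and integers $l=l(n)\ge 0$ (for example, $l$ constant). For every $n$ let $\Xi=\Xi_n$ be a random $n\times l$ sparse sign matrix with parameter $p$, i.e. its entries are i.i.d. with $\mathbb P(\xi_{ij}=1/\sqrt p)=\mathbb P(\xi_{ij}=-1/\sqrt p)=p/2$ and $\mathbb P(\xi_{ij}=0)=1-p$, and let $U=U_n=(u_{ij})$ be a deterministic $n\times n$ orthogonal matrix such that $$\max_{1\le i,j\le n}|u_{ij}|\le\varepsilon_n,\qquad\text{where }\varepsilon_n\to0\text{ as }n\to\infty .$$ Then $U\Xi$ converges in distribution to a standard Gaussian matrix (independent $N(0,1)$ entries) as $n\to\infty$, in the following sense: for all fixed $k$ and $m$, the $k\times m$ submatrix of $U_n\Xi_n$ formed by any $k$ distinct rows and $m$ distinct columns converges in distribution to a $k\times m$ standard Gaussian matrix as $n\to\infty$, uniformly in the choice (which may depend on $n$) of these rows and columns. -/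

import Mathlib

open MeasureTheory ProbabilityTheory Filter Topology

/-- The law of one entry of a sparse sign matrix with parameter `p`: mass `p / 2` at `1 / √p`,
mass `1 - p` at `0` and mass `p / 2` at `-1 / √p`. -/
noncomputable def sparseSignLaw (p : ℝ) : Measure ℝ :=
  ENNReal.ofReal (p / 2) • Measure.dirac (1 / √p) + ENNReal.ofReal (1 - p) • Measure.dirac 0 +
    ENNReal.ofReal (p / 2) • Measure.dirac (-1 / √p)

/-- The random `n × l` matrix `Ξ` is a sparse sign matrix with parameter `p ∈ (0, 1)`: its entries
are independent and each of them has the law `sparseSignLaw p`. -/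
structure IsSparseSignMatrix {Ω : Type*} [MeasurableSpace Ω] (P : Measure Ω) (p : ℝ) {n l : ℕ}
    (Ξ : Ω → Matrix (Fin n) (Fin l) ℝ) : Prop where
  param_mem : p ∈ Set.Ioo (0 : ℝ) 1
  hasLaw : ∀ i j, HasLaw (fun ω => Ξ ω i j) (sparseSignLaw p) P
  indep : iIndepFun (fun (q : Fin n × Fin l) ω => Ξ ω q.1 q.2) P

/-- The maximal absolute value of the entries of the `n × n` matrix `U n` is at most `ε n`, for
some `ε n → 0`. -/
def EntriesVanish (U : ∀ n : ℕ, Matrix (Fin n) (Fin n) ℝ) : Prop :=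
  ∃ ε : ℕ → ℝ, Tendsto ε atTop (𝓝 0) ∧ ∀ n i j, |U n i j| ≤ ε n

/-- The law of a `k × m` standard Gaussian matrix: the entries are independent `N(0, 1)`. -/
noncomputable def stdGaussianMatrixLaw (k m : ℕ) : Measure (Fin k → Fin m → ℝ) :=
  Measure.pi fun _ => Measure.pi fun _ => gaussianReal 0 1

instance (k m : ℕ) : IsProbabilityMeasure (stdGaussianMatrixLaw k m) := by
  unfold stdGaussianMatrixLaw; infer_instance

/-- A size `n` together with a choice of `k` distinct rows and `m` distinct columns (in any order)
of an `n × l n` matrix. -/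
abbrev SubmatrixPosition (l : ℕ → ℕ) (k m : ℕ) : Type :=
  Σ n : ℕ, (Fin k ↪ Fin n) × (Fin m ↪ Fin (l n))

/-- The random matrices `X n`, of the growing size `n × l n`, converge in distribution to a standard
Gaussian matrix as `n → ∞`: for all fixed `k` and `m`, the `k × m` submatrices of `X n` converge in
distribution to a `k × m` standard Gaussian matrix as `n → ∞`, uniformly in the position of the
submatrix. (Convergence along `comap Sigma.fst atTop` is convergence as the size `n` tends to
infinity, whatever rows and columns are chosen for each `n`; the limit is the identity map on the
space of `k × m` arrays with the law of a standard Gaussian matrix.) -/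
def TendstoStdGaussianMatrix {Ω : ℕ → Type*} [∀ n, MeasurableSpace (Ω n)]
    (P : ∀ n, Measure (Ω n)) [∀ n, IsProbabilityMeasure (P n)] {l : ℕ → ℕ}
    (X : ∀ n, Ω n → Matrix (Fin n) (Fin (l n)) ℝ) : Prop :=
  ∀ k m : ℕ, TendstoInDistribution
    (fun (s : SubmatrixPosition l k m) (ω : Ω s.1) (a : Fin k) (b : Fin m) =>
      X s.1 ω (s.2.1 a) (s.2.2 b))
    (comap Sigma.fst atTop) id (fun s => P s.1) (stdGaussianMatrixLaw k m)

/-! By Lévy's theorem (`tendstoInDistribution_stdGaussianMatrix`) it suffices to compare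
characteristic functions. Pairing the submatrix with `t` gives a linear form in the independent
signs, with coefficients `v (j, b) = ∑ a, U (r a) j * t (a, b)`, so its characteristic function is a
product of values of `sparseSignChar p`. Orthonormality of the rows gives `∑ v² = ∑ t²`, exactly the
Gaussian variance (`sum_sq_vecMul_orthogonal`), and small entries of `U` make every `v` small. A
sign has variance 1 and no third moment, so each factor is Gaussian up to `O(v⁴)`; the total error
is `O(max v² * ∑ v²) = O(ε²)` (`abs_prod_sparseSignChar_sub_le`), whatever the rows and columns. -/

/-! ### Comparison of sparse sign and Gaussian characteristic functions -/

/-- The (real) characteristic function of a sparse sign entry. -/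
noncomputable def sparseSignChar (p s : ℝ) : ℝ := 1 - p + p * Real.cos (s / √p)

lemma integral_exp_sparseSignLaw {p : ℝ} (hp : p ∈ Set.Ioo (0 : ℝ) 1) (s : ℝ) :
    ∫ x, Complex.exp ((s * x : ℝ) * Complex.I) ∂(sparseSignLaw p) = (sparseSignChar p s : ℂ) := by
  have h0 : (0 : ℝ) ≤ p / 2 := by linarith [hp.1]
  have h1 : (0 : ℝ) ≤ 1 - p := by linarith [hp.2]
  have hint : ∀ (c a : ℝ), Integrable (fun x : ℝ => Complex.exp ((s * x : ℝ) * Complex.I))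
      (ENNReal.ofReal c • Measure.dirac a) := fun c a =>
    (integrable_dirac (by simp)).smul_measure ENNReal.ofReal_ne_top
  rw [sparseSignLaw, integral_add_measure ((hint _ _).add_measure (hint _ _)) (hint _ _),
    integral_add_measure (hint _ _) (hint _ _)]
  simp only [integral_smul_measure, integral_dirac, ENNReal.toReal_ofReal h0,
    ENNReal.toReal_ofReal h1, sparseSignChar]
  have e : ((s * (-1 / √p) : ℝ) : ℂ) * Complex.I = -((s / √p : ℝ) : ℂ) * Complex.I := by
    push_cast; ring
  rw [e, mul_one_div]
  simp only [Complex.real_smul]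
  push_cast
  rw [Complex.cos]
  simp
  ring

lemma abs_sparseSignChar_le_one {p : ℝ} (hp : p ∈ Set.Ioo (0 : ℝ) 1) (s : ℝ) :
    |sparseSignChar p s| ≤ 1 := by
  unfold sparseSignChar
  have h1 := Real.cos_le_one (s / √p)
  have h2 := Real.neg_one_le_cos (s / √p)
  rw [abs_le]
  constructor <;> nlinarith [hp.1, hp.2]

/-- Taylor's bound covers `|x| ≤ 1`; beyond that, crude bounds suffice because `x ^ 2 ≤ x ^ 4`. -/
lemma abs_cos_sub_le (x : ℝ) : |Real.cos x - (1 - x ^ 2 / 2)| ≤ x ^ 4 / 2 := by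
  rcases le_or_gt |x| 1 with h | h
  · have h4 : |x| ^ 4 = x ^ 4 := by rw [← abs_pow]; exact abs_of_nonneg (by positivity)
    have := Real.cos_bound h
    rw [h4] at this
    have : 0 ≤ x ^ 4 := by positivity
    linarith
  · have hx : 1 ≤ x ^ 2 := by rw [← sq_abs]; nlinarith
    rw [abs_le]
    constructor
    · have := Real.one_sub_sq_div_two_le_cos (x := x)
      have : 0 ≤ x ^ 4 := by positivity
      linarith
    · nlinarith [Real.cos_le_one x]

lemma abs_exp_neg_sub_le {y : ℝ} (hy : 0 ≤ y) : |Real.exp (-y) - (1 - y)| ≤ y ^ 2 := by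
  rcases le_or_gt y 1 with h | h
  · have := Real.abs_exp_sub_one_sub_id_le (x := -y) (by rwa [abs_neg, abs_of_nonneg hy])
    rw [neg_sq] at this
    convert this using 2
    ring
  · have h1 : Real.exp (-y) ≤ 1 := Real.exp_le_one_iff.2 (by linarith)
    have h2 := Real.add_one_le_exp (-y)
    rw [abs_le]
    constructor <;> nlinarith

/-- Both functions expand as `1 - s ^ 2 / 2`: the weight `p` cancels the scaling `1 / √p`. The
cosine remainder contributes `1 / (2 * p)`, the exponential one `1 / 4`. -/
lemma abs_sparseSignChar_sub_le {p : ℝ} (hp : p ∈ Set.Ioo (0 : ℝ) 1) (s : ℝ) :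
    |sparseSignChar p s - Real.exp (-(s ^ 2 / 2))| ≤ (1 / (2 * p) + 1 / 4) * s ^ 4 := by
  have hp0 : p ≠ 0 := hp.1.ne'
  have hsq : √p ^ 2 = p := Real.sq_sqrt hp.1.le
  have h2 : (s / √p) ^ 2 = s ^ 2 / p := by rw [div_pow, hsq]
  have h4 : (s / √p) ^ 4 = s ^ 4 / p ^ 2 := by
    rw [show (s / √p) ^ 4 = ((s / √p) ^ 2) ^ 2 by ring, h2]; ring
  have hc := abs_cos_sub_le (s / √p)
  have he := abs_exp_neg_sub_le (y := s ^ 2 / 2) (by positivity)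
  rw [h2, h4] at hc
  have e : sparseSignChar p s - Real.exp (-(s ^ 2 / 2)) =
      p * (Real.cos (s / √p) - (1 - s ^ 2 / p / 2)) -
        (Real.exp (-(s ^ 2 / 2)) - (1 - s ^ 2 / 2)) := by
    unfold sparseSignChar
    field_simp
    ring
  rw [e]
  refine (abs_sub _ _).trans ?_
  rw [abs_mul, abs_of_pos hp.1]
  refine (add_le_add (mul_le_mul_of_nonneg_left hc hp.1.le) he).trans (le_of_eq ?_)
  field_simp
  ring

/-- Factors are exchanged one at a time; the others have modulus at most 1. -/
lemma abs_prod_sub_prod_le {ι : Type*} (s : Finset ι) (f g : ι → ℝ) (hf : ∀ i, |f i| ≤ 1)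
    (hg : ∀ i, |g i| ≤ 1) : |∏ i ∈ s, f i - ∏ i ∈ s, g i| ≤ ∑ i ∈ s, |f i - g i| := by
  classical
  induction s using Finset.induction_on with
  | empty => simp
  | insert a s ha ih =>
    rw [Finset.prod_insert ha, Finset.prod_insert ha, Finset.sum_insert ha]
    have hG : |∏ i ∈ s, g i| ≤ 1 := by
      rw [Finset.abs_prod]
      exact Finset.prod_le_one (fun _ _ => abs_nonneg _) fun i _ => hg i
    calc |f a * ∏ i ∈ s, f i - g a * ∏ i ∈ s, g i|
        = |(f a - g a) * ∏ i ∈ s, g i + f a * (∏ i ∈ s, f i - ∏ i ∈ s, g i)| := by ring_nf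
      _ ≤ |f a - g a| * |∏ i ∈ s, g i| + |f a| * |∏ i ∈ s, f i - ∏ i ∈ s, g i| := by
        rw [← abs_mul, ← abs_mul]; exact abs_add_le _ _
      _ ≤ |f a - g a| * 1 + 1 * |∏ i ∈ s, f i - ∏ i ∈ s, g i| := by
        gcongr
        exact hf a
      _ ≤ _ := by linarith

/-- A Lindeberg-type estimate: the characteristic function of a linear combination of sparse signs
is close to that of a Gaussian when all the coefficients are small. -/
lemma abs_prod_sparseSignChar_sub_le {p : ℝ} (hp : p ∈ Set.Ioo (0 : ℝ) 1) {ι : Type*} [Fintype ι]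
    (c : ι → ℝ) {δ S : ℝ} (hδ : ∀ i, |c i| ≤ δ) (hS : ∑ i, c i ^ 2 = S) :
    |∏ i, sparseSignChar p (c i) - Real.exp (-(S / 2))| ≤
      (1 / (2 * p) + 1 / 4) * δ ^ 2 * S := by
  have hp0 := hp.1
  have e : Real.exp (-(S / 2)) = ∏ i, Real.exp (-(c i ^ 2 / 2)) := by
    rw [← Real.exp_sum, Finset.sum_neg_distrib, ← Finset.sum_div, hS]
  rw [e, ← hS, Finset.mul_sum]
  refine (abs_prod_sub_prod_le _ _ _ (fun i => abs_sparseSignChar_le_one hp _) fun i => ?_).trans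
    (Finset.sum_le_sum fun i _ => (abs_sparseSignChar_sub_le hp (c i)).trans ?_)
  · rw [Real.abs_exp]
    exact Real.exp_le_one_iff.2 (by have := sq_nonneg (c i); linarith)
  -- One factor `c i ^ 2` is bounded by `δ ^ 2`; the other is kept and sums to `S`.
  · rw [show c i ^ 4 = c i ^ 2 * c i ^ 2 by ring, mul_assoc]
    have : c i ^ 2 ≤ δ ^ 2 := by
      rw [← sq_abs]
      exact pow_le_pow_left₀ (abs_nonneg _) (hδ i) 2
    gcongr

/-- A linear combination of distinct rows of an orthogonal matrix has the norm of its vector of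
coefficients. -/
lemma sum_sq_vecMul_orthogonal {n k : ℕ} {U : Matrix (Fin n) (Fin n) ℝ}
    (hU : U ∈ Matrix.orthogonalGroup (Fin n) ℝ) (r : Fin k ↪ Fin n) (t : Fin k → ℝ) :
    ∑ j, (∑ a, U (r a) j * t a) ^ 2 = ∑ a, t a ^ 2 := by
  have hUU : ∀ a a' : Fin k, ∑ j, U (r a) j * U (r a') j = if a = a' then 1 else 0 := by
    intro a a'
    have h := congrFun (congrFun (Matrix.mem_orthogonalGroup_iff (Fin n) ℝ |>.1 hU) (r a)) (r a')
    simpa [Matrix.mul_apply, Matrix.one_apply] using h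
  calc ∑ j, (∑ a, U (r a) j * t a) ^ 2
      = ∑ j, ∑ a, ∑ a', t a * t a' * (U (r a) j * U (r a') j) := by
        refine Finset.sum_congr rfl fun j _ => ?_
        rw [sq, Finset.sum_mul_sum]
        exact Finset.sum_congr rfl fun a _ => Finset.sum_congr rfl fun a' _ => by ring
    _ = ∑ a, ∑ a', t a * t a' * ∑ j, U (r a) j * U (r a') j := by
        rw [Finset.sum_comm]
        refine Finset.sum_congr rfl fun a _ => ?_
        rw [Finset.sum_comm]
        exact Finset.sum_congr rfl fun a' _ => (Finset.mul_sum _ _ _).symm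
    _ = ∑ a, t a ^ 2 := by simp [hUU, sq]

/-! ### Lévy continuity for random arrays -/

/-- A `k × m` array as a vector of the Euclidean space of dimension `km`. -/
def arrayToEuclidean (k m : ℕ) (x : Fin k → Fin m → ℝ) : EuclideanSpace ℝ (Fin k × Fin m) :=
  WithLp.toLp 2 fun q => x q.1 q.2

lemma continuous_arrayToEuclidean (k m : ℕ) : Continuous (arrayToEuclidean k m) := by
  unfold arrayToEuclidean
  fun_prop

lemma charFun_map_arrayToEuclidean {Ω : Type*} [MeasurableSpace Ω] {P : Measure Ω} {k m : ℕ}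
    {X : Ω → Fin k → Fin m → ℝ} (hX : AEMeasurable X P) (t : EuclideanSpace ℝ (Fin k × Fin m)) :
    charFun (P.map fun ω => arrayToEuclidean k m (X ω)) t =
      ∫ ω, Complex.exp ((∑ a, ∑ b, X ω a b * t (a, b) : ℝ) * Complex.I) ∂P := by
  have hm : AEMeasurable (fun ω => arrayToEuclidean k m (X ω)) P :=
    (continuous_arrayToEuclidean k m).measurable.comp_aemeasurable hX
  rw [charFun_apply, integral_map hm (by fun_prop)]
  have hin : ∀ ω, inner ℝ (arrayToEuclidean k m (X ω)) t = ∑ a, ∑ b, X ω a b * t (a, b) := by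
    intro ω
    simp only [arrayToEuclidean, PiLp.inner_apply, Fintype.sum_prod_type, RCLike.inner_apply,
      conj_trivial]
    exact Finset.sum_congr rfl fun a _ => Finset.sum_congr rfl fun b _ => mul_comm _ _
  simp_rw [hin]

lemma charFun_stdGaussianMatrixLaw {k m : ℕ} (t : EuclideanSpace ℝ (Fin k × Fin m)) :
    charFun ((stdGaussianMatrixLaw k m).map (arrayToEuclidean k m)) t =
      (Real.exp (-((∑ q, t q ^ 2) / 2)) : ℂ) := by
  have h := charFun_map_arrayToEuclidean (P := stdGaussianMatrixLaw k m) (X := id) aemeasurable_id t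
  refine h.trans ?_
  have hprod : ∀ x : Fin k → Fin m → ℝ,
      Complex.exp ((∑ a, ∑ b, x a b * t (a, b) : ℝ) * Complex.I) =
        ∏ a, ∏ b, Complex.exp ((t (a, b) : ℂ) * (x a b : ℂ) * Complex.I) := by
    intro x
    simp_rw [← Complex.exp_sum]
    push_cast
    simp_rw [Finset.sum_mul]
    exact congrArg _ (Finset.sum_congr rfl fun a _ => Finset.sum_congr rfl fun b _ => by ring)
  simp only [id, hprod, stdGaussianMatrixLaw]
  rw [integral_fintype_prod_eq_prod
    (μ := fun _ : Fin k => Measure.pi fun _ : Fin m => gaussianReal 0 1)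
    (f := fun a (y : Fin m → ℝ) => ∏ b, Complex.exp ((t (a, b) : ℂ) * (y b : ℂ) * Complex.I))]
  have hin : ∀ a, ∫ y : Fin m → ℝ, ∏ b, Complex.exp ((t (a, b) : ℂ) * (y b : ℂ) * Complex.I)
      ∂(Measure.pi fun _ : Fin m => gaussianReal 0 1) =
      ∏ b, Complex.exp (-((t (a, b) : ℂ) ^ 2 / 2)) := by
    intro a
    rw [integral_fintype_prod_eq_prod (μ := fun _ : Fin m => gaussianReal 0 1)
      (f := fun b (y : ℝ) => Complex.exp ((t (a, b) : ℂ) * (y : ℂ) * Complex.I))]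
    refine Finset.prod_congr rfl fun b _ => ?_
    rw [← charFun_apply_real, charFun_gaussianReal]
    simp
  simp_rw [hin, ← Complex.exp_sum]
  rw [Fintype.sum_prod_type]
  push_cast
  simp_rw [Finset.sum_neg_distrib, Finset.sum_div]

/-- Lévy's continuity theorem for random arrays, along a countably generated filter. -/
lemma tendstoInDistribution_stdGaussianMatrix {ι : Type*} {L : Filter ι} [L.IsCountablyGenerated]
    {Ω : ι → Type*} [∀ i, MeasurableSpace (Ω i)] (P : ∀ i, Measure (Ω i))
    [∀ i, IsProbabilityMeasure (P i)] {k m : ℕ} (X : ∀ i, Ω i → Fin k → Fin m → ℝ)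
    (hX : ∀ i, AEMeasurable (X i) (P i))
    (h : ∀ t : EuclideanSpace ℝ (Fin k × Fin m), Tendsto
      (fun i => ∫ ω, Complex.exp ((∑ a, ∑ b, X i ω a b * t (a, b) : ℝ) * Complex.I) ∂(P i)) L
      (𝓝 (Real.exp (-((∑ q, t q ^ 2) / 2)) : ℂ))) :
    TendstoInDistribution X L id P (stdGaussianMatrixLaw k m) := by
  have hc := continuous_arrayToEuclidean k m
  have hY : TendstoInDistribution (fun i ω => arrayToEuclidean k m (X i ω)) L
      (arrayToEuclidean k m) P (stdGaussianMatrixLaw k m) := by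
    refine ⟨fun i => hc.measurable.comp_aemeasurable (hX i), hc.measurable.aemeasurable, ?_⟩
    -- Lévy's theorem is applied along sequences, which suffice for a countably generated filter.
    refine tendsto_of_seq_tendsto fun u hu => ?_
    refine ProbabilityMeasure.tendsto_of_tendsto_charFun fun t => ?_
    simp only [ProbabilityMeasure.coe_mk, charFun_stdGaussianMatrixLaw]
    exact ((h t).comp hu).congr fun j => (charFun_map_arrayToEuclidean (hX (u j)) t).symm
  exact hY.continuous_comp (g := fun y a b => y (a, b)) (by fun_prop)

/-! ### Characteristic functions of the submatrices -/

lemma IsSparseSignMatrix.aemeasurable_entry {Ω : Type*} [MeasurableSpace Ω] {P : Measure Ω} {p : ℝ}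
    {n l : ℕ} {Ξ : Ω → Matrix (Fin n) (Fin l) ℝ} (hΞ : IsSparseSignMatrix P p Ξ) (i : Fin n)
    (j : Fin l) : AEMeasurable (fun ω => Ξ ω i j) P :=
  (hΞ.hasLaw i j).aemeasurable

lemma IsSparseSignMatrix.integral_exp_submatrix {Ω : Type*} [MeasurableSpace Ω] {P : Measure Ω}
    [IsProbabilityMeasure P] {p : ℝ} {n l k m : ℕ} {Ξ : Ω → Matrix (Fin n) (Fin l) ℝ}
    (hΞ : IsSparseSignMatrix P p Ξ) (U : Matrix (Fin n) (Fin n) ℝ) (r : Fin k → Fin n)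
    (c : Fin m ↪ Fin l) (t : Fin k × Fin m → ℝ) :
    ∫ ω, Complex.exp ((∑ a, ∑ b, (U * Ξ ω) (r a) (c b) * t (a, b) : ℝ) * Complex.I) ∂P =
      ((∏ q : Fin n × Fin m, sparseSignChar p (∑ a, U (r a) q.1 * t (a, q.2)) : ℝ) : ℂ) := by
  set v : Fin n × Fin m → ℝ := fun q => ∑ a, U (r a) q.1 * t (a, q.2) with hv
  have hsum : ∀ ω, ∑ a, ∑ b, (U * Ξ ω) (r a) (c b) * t (a, b) =
      ∑ q : Fin n × Fin m, v q * Ξ ω q.1 (c q.2) := by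
    intro ω
    simp only [hv, Matrix.mul_apply, Fintype.sum_prod_type, Finset.sum_mul]
    rw [Finset.sum_comm]
    conv_rhs => rw [Finset.sum_comm]
    refine Finset.sum_congr rfl fun b _ => ?_
    rw [Finset.sum_comm]
    exact Finset.sum_congr rfl fun j _ => Finset.sum_congr rfl fun a _ => by ring
  -- Distinctness of the columns is what preserves independence.
  have hinj : Function.Injective fun q : Fin n × Fin m => (q.1, c q.2) := by
    rintro ⟨i, b⟩ ⟨i', b'⟩ h
    simpa using h
  have hind : iIndepFun (fun (q : Fin n × Fin m) ω => Ξ ω q.1 (c q.2)) P := hΞ.indep.precomp hinj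
  have hprod : ∀ ω, Complex.exp ((∑ q : Fin n × Fin m, v q * Ξ ω q.1 (c q.2) : ℝ) * Complex.I) =
      ∏ q : Fin n × Fin m, Complex.exp ((v q * Ξ ω q.1 (c q.2) : ℝ) * Complex.I) := by
    intro ω
    rw [← Complex.exp_sum]
    push_cast
    rw [Finset.sum_mul]
  simp_rw [hsum, hprod]
  rw [hind.integral_fun_prod_comp (f := fun q x => Complex.exp ((v q * x : ℝ) * Complex.I))
    (fun q => hΞ.aemeasurable_entry _ _)
    (fun q => (by fun_prop : Continuous fun x : ℝ =>
      Complex.exp ((v q * x : ℝ) * Complex.I)).aestronglyMeasurable)]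
  rw [Complex.ofReal_prod]
  refine Finset.prod_congr rfl fun q _ => ?_
  rw [← integral_exp_sparseSignLaw hΞ.param_mem, ← (hΞ.hasLaw q.1 (c q.2)).map_eq,
    integral_map (hΞ.aemeasurable_entry _ _) (by fun_prop)]

lemma IsSparseSignMatrix.norm_integral_exp_submatrix_sub_le {Ω : Type*} [MeasurableSpace Ω]
    {P : Measure Ω} [IsProbabilityMeasure P] {p : ℝ} {n l k m : ℕ}
    {Ξ : Ω → Matrix (Fin n) (Fin l) ℝ} (hΞ : IsSparseSignMatrix P p Ξ)
    {U : Matrix (Fin n) (Fin n) ℝ} (hU : U ∈ Matrix.orthogonalGroup (Fin n) ℝ) {ε : ℝ}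
    (hε : ∀ i j, |U i j| ≤ ε) (r : Fin k ↪ Fin n) (c : Fin m ↪ Fin l) (t : Fin k × Fin m → ℝ) :
    ‖∫ ω, Complex.exp ((∑ a, ∑ b, (U * Ξ ω) (r a) (c b) * t (a, b) : ℝ) * Complex.I) ∂P -
      (Real.exp (-((∑ q, t q ^ 2) / 2)) : ℂ)‖ ≤
      (1 / (2 * p) + 1 / 4) * (ε * ∑ q, |t q|) ^ 2 * ∑ q, t q ^ 2 := by
  rw [hΞ.integral_exp_submatrix, ← Complex.ofReal_sub, Complex.norm_real, Real.norm_eq_abs]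
  refine abs_prod_sparseSignChar_sub_le hΞ.param_mem _ (fun q => ?_) ?_
  -- The index `q` supplies an entry of `U`; for `n = 0` the sign of `ε` is unknown.
  · have hε0 : 0 ≤ ε := (abs_nonneg _).trans (hε q.1 q.1)
    calc |∑ a, U (r a) q.1 * t (a, q.2)| ≤ ∑ a, |U (r a) q.1 * t (a, q.2)| :=
          Finset.abs_sum_le_sum_abs _ _
      _ ≤ ∑ a, ε * |t (a, q.2)| := by
          refine Finset.sum_le_sum fun a _ => ?_
          rw [abs_mul]
          exact mul_le_mul_of_nonneg_right (hε _ _) (abs_nonneg _)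
      _ = ε * ∑ a, |t (a, q.2)| := (Finset.mul_sum _ _ _).symm
      _ ≤ ε * ∑ q, |t q| := by
          refine mul_le_mul_of_nonneg_left ?_ hε0
          rw [Fintype.sum_prod_type]
          exact Finset.sum_le_sum fun a _ => Finset.single_le_sum
            (f := fun b => |t (a, b)|) (fun b _ => abs_nonneg _) (Finset.mem_univ q.2)
  -- Orthogonality is used separately for each column `b` of `t`.
  · rw [Fintype.sum_prod_type_right, Fintype.sum_prod_type_right]
    exact Finset.sum_congr rfl fun b _ => sum_sq_vecMul_orthogonal hU r fun a => t (a, b)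

theorem proposition3p5 (p : ℝ) (l : ℕ → ℕ)
    {Ω : ℕ → Type*} [∀ n, MeasurableSpace (Ω n)]
    (P : ∀ n, Measure (Ω n)) [∀ n, IsProbabilityMeasure (P n)]
    (Ξ : ∀ n, Ω n → Matrix (Fin n) (Fin (l n)) ℝ)
    (hΞ : ∀ n, IsSparseSignMatrix (P n) p (Ξ n))
    (U : ∀ n : ℕ, Matrix (Fin n) (Fin n) ℝ)
    (hU : ∀ n, U n ∈ Matrix.orthogonalGroup (Fin n) ℝ)
    (hε : EntriesVanish U) :
    TendstoStdGaussianMatrix P (fun n ω => U n * Ξ n ω) := by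
  intro k m
  obtain ⟨ε, hε0, hUε⟩ := hε
  refine tendstoInDistribution_stdGaussianMatrix (fun s : SubmatrixPosition l k m => P s.1) _
    (fun s => ?_) fun t => ?_
  · refine aemeasurable_pi_lambda _ fun a => aemeasurable_pi_lambda _ fun b => ?_
    simp only [Matrix.mul_apply]
    exact Finset.aemeasurable_fun_sum _ fun j _ =>
      ((hΞ s.1).aemeasurable_entry j (s.2.2 b)).const_mul _
  · have hlim : Tendsto (fun n => (1 / (2 * p) + 1 / 4) * (ε n * ∑ q, |t q|) ^ 2 * ∑ q, t q ^ 2)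
        atTop (𝓝 0) := by
      simpa using (((hε0.mul_const (∑ q, |t q|)).pow 2).const_mul
        (1 / (2 * p) + 1 / 4)).mul_const (∑ q, t q ^ 2)
    rw [tendsto_iff_norm_sub_tendsto_zero]
    -- The bound depends on the position `s` only through its size `s.1`, whence uniformity.
    exact squeeze_zero (fun _ => norm_nonneg _)
      (fun s => (hΞ s.1).norm_integral_exp_submatrix_sub_le (hU s.1) (hUε s.1) s.2.1 s.2.2 t)
      (hlim.comp tendsto_comap)
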